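/- Fix a countably saturated nonstandard universe, that is, an extension $a\mapsto{}^*a$ of the superstructure over $\mathbb N$ which satisfies the transfer principle and in which every countable family of internal sets with the finite intersection property has nonempty intersection; let ${}^*\mathbb N$ be its set of hyperintegers. A subset $X$ of ${}^*\mathbb N$ (or of ${}^*\mathbb N\times{}^*\mathbb N$) is called countably determined (CD) if there are internal sets $X_m$ ($m\in\mathbb N$) and a set $B\subseteq\mathcal P(\mathbb N)$ such that $$X=\bigcup_{b\in B}\Bigl(\bigcap_{m\in b}X_m\cap\bigcap_{m\notin b}\overline X_m\Bigr),\qquad \overline X_m=\Bigl(\bigcup_n X_n\Bigr)\setminus X_m .$$ A map is CD if its graph is CD. Theorem. Let $E$ be an equivalence relation on ${}^*\mathbb N$ which is CD as a subset of ${}^*\mathbb N\times{}^*\mathbb N$ and all of whose equivalence classes are at most countable. Then $E$ has a CD transversal, that is, there is a CD set $T\subseteq{}^*\mathbb N$ which has exactly one element in common with each $E$-class. Hence $E$ is CD-smooth, that is, there is a CD map $\vartheta:{}^*\mathbb N\to{}^*\mathbb N$ such that for all $x,y\in{}^*\mathbb N$: $x\mathrel E y$ if and only if $\vartheta(x)=\vartheta(y)$.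 -/

import Mathlib

universe u

namespace NonstandardDST

/-- The superstructure over `ℕ`, presented level by level:
`ℕ`, `𝒫(ℕ)`, `𝒫(𝒫(ℕ))`, and so on through all finite levels. Pairs, relations, functions, families
of sets, etc. are coded in it as usual, through Kuratowski pairs. -/
def Level : ℕ → Type
  | 0 => ℕ
  | n + 1 => Set (Level n)

/-- A structure with a domain of objects of each finite level and a membership relation
between consecutive levels. -/
structure LevelStructure where
  Obj : ℕ → Type u
  mem : ∀ n : ℕ, Obj n → Obj (n + 1) → Prop

/-- The standard universe: the full superstructure over `ℕ` with its true membership. -/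
abbrev standard : LevelStructure.{0} where
  Obj := Level
  mem := fun n a (b : Set (Level n)) => a ∈ b

/-- Formulas of set theory in which every quantifier is bounded by a level. The variables of
level `n` are `v n 0, v n 1, v n 2, …`. -/
inductive Formula : Type
  /-- `v n i = v n j` -/
  | eq (n i j : ℕ) : Formula
  /-- `v n i ∈ v (n + 1) j` -/
  | mem (n i j : ℕ) : Formula
  | neg (φ : Formula) : Formula
  | and (φ ψ : Formula) : Formula
  /-- `∀ v n i, φ`, the quantifier running over all objects of level `n` -/
  | all (n i : ℕ) (φ : Formula) : Formula

/-- Truth of a formula in `S`, the variables being evaluated by `e`. -/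
def LevelStructure.Sat (S : LevelStructure.{u}) : Formula → (∀ n : ℕ, ℕ → S.Obj n) → Prop
  | .eq n i j, e => e n i = e n j
  | .mem n i j, e => S.mem n (e n i) (e (n + 1) j)
  | .neg φ, e => ¬ S.Sat φ e
  | .and φ ψ, e => S.Sat φ e ∧ S.Sat ψ e
  | .all n i φ, e =>
      ∀ a : S.Obj n, S.Sat φ (Function.update e n (Function.update (e n) i a))

/-- A nonstandard universe over the superstructure of `ℕ`: `Obj n` is the set of the internal
objects of level `n`, that is, the elements of `*(Level n)` (so `Obj 0` is `*ℕ`, `Obj 1` is the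
set of the internal subsets of `*ℕ`, and so on), and `star` is the map `a ↦ *a`, subject to the
transfer principle for all formulas with arbitrary standard parameters. -/
structure NonstandardUniverse extends LevelStructure.{u} where
  star : ∀ n : ℕ, Level n → Obj n
  transfer : ∀ (φ : Formula) (e : ∀ n : ℕ, ℕ → Level n),
    standard.Sat φ e ↔ toLevelStructure.Sat φ (fun n i => star n (e n i))

namespace NonstandardUniverse

variable (U : NonstandardUniverse.{u})

/-- Countable saturation: every sequence of internal sets (of any level) in which any finitely
many sets have a common element has a common element. -/
def CountablySaturated : Prop :=
  ∀ (n : ℕ) (b : ℕ → U.Obj (n + 1)),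
    (∀ k : ℕ, ∃ x : U.Obj n, ∀ i ≤ k, U.mem n x (b i)) →
      ∃ x : U.Obj n, ∀ i : ℕ, U.mem n x (b i)

/-- The set `*ℕ` of hyperintegers. -/
abbrev HyperNat : Type u := U.Obj 0

/-- `p` is the Kuratowski pair `{{x}, {x, y}}` of the hyperintegers `x` and `y`. -/
def IsPair (p : U.Obj 2) (x y : U.HyperNat) : Prop :=
  ∀ c : U.Obj 1, U.mem 1 c p ↔
    (∀ z : U.HyperNat, U.mem 0 z c ↔ z = x) ∨
      (∀ z : U.HyperNat, U.mem 0 z c ↔ z = x ∨ z = y)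

/-- Internal subsets of `*ℕ`. -/
def IsInternal (X : Set U.HyperNat) : Prop :=
  ∃ b : U.Obj 1, X = {x | U.mem 0 x b}

/-- Internal subsets of `*ℕ × *ℕ`. -/
def IsInternalRel (P : Set (U.HyperNat × U.HyperNat)) : Prop :=
  ∃ b : U.Obj 3, P = {q | ∃ p : U.Obj 2, U.IsPair p q.1 q.2 ∧ U.mem 2 p b}

end NonstandardUniverse

/-- `X` is countably determined over a class `𝓘` of sets: for some sets `Y m ∈ 𝓘` and some
`B ⊆ 𝒫(ℕ)`, `X` is the union over `b ∈ B` of the intersection of all `Y m` with `m ∈ b` and all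
`(⋃ n, Y n) \ Y m` with `m ∉ b`. -/
def CountablyDetermined {α : Type u} (𝓘 : Set α → Prop) (X : Set α) : Prop :=
  ∃ (Y : ℕ → Set α) (B : Set (Set ℕ)), (∀ m, 𝓘 (Y m)) ∧
    X = ⋃ b ∈ B, ((⋂ m ∈ b, Y m) ∩ ⋂ m ∈ bᶜ, ((⋃ n, Y n) \ Y m))

namespace NonstandardUniverse

variable (U : NonstandardUniverse.{u})

/-- Countably determined subsets of `*ℕ`. -/
def IsCD (X : Set U.HyperNat) : Prop :=
  CountablyDetermined U.IsInternal X

/-- Countably determined subsets of `*ℕ × *ℕ`. -/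
def IsCDRel (P : Set (U.HyperNat × U.HyperNat)) : Prop :=
  CountablyDetermined U.IsInternalRel P

/-- A map `*ℕ → *ℕ` is countably determined if its graph is. -/
def IsCDMap (θ : U.HyperNat → U.HyperNat) : Prop :=
  U.IsCDRel {q | θ q.1 = q.2}

/-- An equivalence relation on `*ℕ` is CD-smooth if it is CD-reducible to equality on `*ℕ`. -/
def CDSmooth (E : Setoid U.HyperNat) : Prop :=
  ∃ θ : U.HyperNat → U.HyperNat, U.IsCDMap θ ∧ ∀ x y, E x y ↔ θ x = θ y

end NonstandardUniverse

/-- `T` has exactly one common element with each equivalence class of `E`. -/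
def IsTransversal {α : Type u} (E : Setoid α) (T : Set α) : Prop :=
  ∀ x : α, ∃! y : α, y ∈ T ∧ E x y

end NonstandardDST

/-
Fix internal sets `Y m` which determine membership in `E`. A class of `E` is a union of sections of
countable intersections of Boolean combinations of the `Y m`. Each of these sections is countable,
hence by saturation already finite at a finite stage of the intersection, so taking least points
again and again covers `E` by countably many internal partial functions `G n`. By
transferred recursion along `<` there is an internal set `A n` which separates every `x` from
`G n x` whenever `G n x < x`. Hence `x ↦ {n | x ∈ A n}` is injective on each class, and choosing the
point with the least value for some well-ordering of `𝒫(ℕ)` gives a transversal. It is countably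
determined because projections of countably determined relations are, again by saturation.
-/

namespace NonstandardDST

/-! ### Formulas -/

namespace LevelStructure

/-- Assignments of objects of `S` to the variables of formulas. -/
abbrev Valuation (S : LevelStructure.{u}) : Type u := ∀ n : ℕ, ℕ → S.Obj n

/-- The valuation `e` with the value of the variable `v n i` changed to `a`, as in the semantics of
quantifiers. -/
def Valuation.assign {S : LevelStructure.{u}} (e : S.Valuation) (n i : ℕ) (a : S.Obj n) :
    S.Valuation :=
  Function.update e n (Function.update (e n) i a)

namespace Valuation

variable {S : LevelStructure.{u}} (e : S.Valuation)

@[simp] theorem assign_same (n i : ℕ) (a : S.Obj n) : e.assign n i a n i = a := by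
  simp [assign]

@[simp] theorem assign_of_ne {m n i j : ℕ} (h : (m, j) ≠ (n, i)) (a : S.Obj n) :
    e.assign n i a m j = e m j := by
  rcases eq_or_ne m n with rfl | hmn
  · have hji : j ≠ i := fun hji => h (hji ▸ rfl)
    simp [assign, hji]
  · simp [assign, hmn]

theorem assign_comm {m n : ℕ} (h : m ≠ n) (i j : ℕ) (a : S.Obj m) (b : S.Obj n) :
    (e.assign m i a).assign n j b = (e.assign n j b).assign m i a := by
  simp only [assign, Function.update_of_ne h, Function.update_of_ne h.symm]
  exact Function.update_comm h _ _ _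

end Valuation

end LevelStructure

namespace Formula

/-- Disjunction, as an abbreviation in the language of `Formula`. -/
def or (φ ψ : Formula) : Formula := .neg (.and (.neg φ) (.neg ψ))

/-- Implication, as an abbreviation in the language of `Formula`. -/
def imp (φ ψ : Formula) : Formula := .neg (.and φ (.neg ψ))

/-- Equivalence, as an abbreviation in the language of `Formula`. -/
def iff (φ ψ : Formula) : Formula := .and (φ.imp ψ) (ψ.imp φ)

/-- Existential quantification over the objects of level `n`. -/
def ex (n i : ℕ) (φ : Formula) : Formula := .neg (.all n i (.neg φ))

/-- `v 2 p` is the Kuratowski pair of `v 0 x` and `v 0 y`; the bound variable `v 0 (x + y + 1)` is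
distinct from both. -/
def pair (p x y : ℕ) : Formula :=
  .all 1 0 (.iff (.mem 1 0 p)
    (.or (.all 0 (x + y + 1) (.iff (.mem 0 (x + y + 1) 0) (.eq 0 (x + y + 1) x)))
      (.all 0 (x + y + 1) (.iff (.mem 0 (x + y + 1) 0)
        (.or (.eq 0 (x + y + 1) x) (.eq 0 (x + y + 1) y))))))

/-- The pair of `v 0 x` and `v 0 y` belongs to `v 3 r`: the formula through which binary relations
are handled. -/
def rel (r x y : ℕ) : Formula := .ex 2 0 (.and (.pair 0 x y) (.mem 2 0 r))

/-- The variables, free or bound, which occur in a formula; `(n, i)` stands for `v n i`. -/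
def vars : Formula → Finset (ℕ × ℕ)
  | .eq n i j => {(n, i), (n, j)}
  | .mem n i j => {(n, i), (n + 1, j)}
  | .neg φ => φ.vars
  | .and φ ψ => φ.vars ∪ ψ.vars
  | .all n i φ => insert (n, i) φ.vars

theorem exists_notMem_vars (φ : Formula) (n : ℕ) : ∃ i, (n, i) ∉ φ.vars := by
  obtain ⟨i, hi⟩ := Infinite.exists_notMem_finset (φ.vars.image Prod.snd)
  exact ⟨i, fun h => hi (Finset.mem_image_of_mem Prod.snd h)⟩

/-- Universal quantification over a list of variables. -/
def allList (l : List (ℕ × ℕ)) (φ : Formula) : Formula := l.foldr (fun v => .all v.1 v.2) φ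

end Formula

namespace LevelStructure

variable (S : LevelStructure.{u})

/-- The binary relation on the objects of level `0` which is coded, as a set of Kuratowski pairs, by
an object of level `3`. It agrees with `NonstandardUniverse.IsPair`, but makes sense for `standard`
as well. -/
def Rel (b : S.Obj 3) (x y : S.Obj 0) : Prop :=
  ∃ p : S.Obj 2, (∀ c : S.Obj 1, S.mem 1 c p ↔
    (∀ z : S.Obj 0, S.mem 0 z c ↔ z = x) ∨
      (∀ z : S.Obj 0, S.mem 0 z c ↔ z = x ∨ z = y)) ∧ S.mem 2 p b

variable {S} {e e' : S.Valuation} {φ ψ : Formula}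

@[simp] theorem sat_eq {n i j : ℕ} : S.Sat (.eq n i j) e ↔ e n i = e n j := Iff.rfl

@[simp] theorem sat_mem {n i j : ℕ} :
    S.Sat (.mem n i j) e ↔ S.mem n (e n i) (e (n + 1) j) := Iff.rfl

@[simp] theorem sat_neg : S.Sat φ.neg e ↔ ¬ S.Sat φ e := Iff.rfl

@[simp] theorem sat_and : S.Sat (φ.and ψ) e ↔ S.Sat φ e ∧ S.Sat ψ e := Iff.rfl

@[simp] theorem sat_all {n i : ℕ} : S.Sat (.all n i φ) e ↔ ∀ a, S.Sat φ (e.assign n i a) := Iff.rfl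

@[simp] theorem sat_or : S.Sat (φ.or ψ) e ↔ S.Sat φ e ∨ S.Sat ψ e := by
  simp only [Formula.or, sat_neg, sat_and]; tauto

@[simp] theorem sat_imp : S.Sat (φ.imp ψ) e ↔ (S.Sat φ e → S.Sat ψ e) := by
  simp only [Formula.imp, sat_neg, sat_and]; tauto

@[simp] theorem sat_iff : S.Sat (φ.iff ψ) e ↔ (S.Sat φ e ↔ S.Sat ψ e) := by
  simp only [Formula.iff, sat_imp, sat_and]; tauto

@[simp] theorem sat_ex {n i : ℕ} : S.Sat (φ.ex n i) e ↔ ∃ a, S.Sat φ (e.assign n i a) := by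
  simp [Formula.ex]

@[simp] theorem sat_rel {r x y : ℕ} :
    S.Sat (.rel r x y) e ↔ S.Rel (e 3 r) (e 0 x) (e 0 y) := by
  have hx : x ≠ x + y + 1 := by omega
  have hy : y ≠ x + y + 1 := by omega
  simp [Formula.rel, Formula.pair, Rel, hx, hy]

theorem sat_congr (h : ∀ n i, (n, i) ∈ φ.vars → e n i = e' n i) : S.Sat φ e ↔ S.Sat φ e' := by
  induction φ generalizing e e' with
  | eq n i j => simp [h n i (by simp [Formula.vars]), h n j (by simp [Formula.vars])]
  | mem n i j => simp [h n i (by simp [Formula.vars]), h (n + 1) j (by simp [Formula.vars])]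
  | neg φ ih => exact not_congr (ih h)
  | and φ ψ ihφ ihψ =>
    exact and_congr (ihφ fun n i hi => h n i (Finset.mem_union_left _ hi))
      (ihψ fun n i hi => h n i (Finset.mem_union_right _ hi))
  | all n i φ ih =>
    refine forall_congr' fun a => ih fun m j hj => ?_
    by_cases hv : (m, j) = (n, i)
    · obtain ⟨rfl, rfl⟩ := Prod.mk.inj hv
      exact (e.assign_same ..).trans (e'.assign_same ..).symm
    · exact (e.assign_of_ne hv a).trans
        ((h m j (Finset.mem_insert_of_mem hj)).trans (e'.assign_of_ne hv a).symm)

theorem sat_assign_of_notMem_vars {n i : ℕ} (h : (n, i) ∉ φ.vars) (a : S.Obj n) :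
    S.Sat φ (e.assign n i a) ↔ S.Sat φ e :=
  sat_congr fun _ _ hv => e.assign_of_ne (fun heq => h (heq ▸ hv)) a

theorem sat_allList {l : List (ℕ × ℕ)} :
    S.Sat (φ.allList l) e ↔
      ∀ e' : S.Valuation, (∀ n i, (n, i) ∉ l → e' n i = e n i) → S.Sat φ e' := by
  induction l generalizing e with
  | nil =>
    exact ⟨fun h e' he' => (sat_congr fun n i _ => he' n i List.not_mem_nil).2 h,
      fun h => h e fun _ _ _ => rfl⟩
  | cons v l ih =>
    refine (forall_congr' fun a => ih).trans ⟨fun h e' he' => ?_, fun h a e' he' => ?_⟩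
    · refine h (e' v.1 v.2) e' fun n i hi => ?_
      by_cases hv : (n, i) = v
      · subst hv
        exact (e.assign_same ..).symm
      · exact (he' n i (by simp [hv, hi])).trans (e.assign_of_ne hv _).symm
    · refine h e' fun n i hi => ?_
      rw [List.mem_cons, not_or] at hi
      exact (he' n i hi.2).trans (e.assign_of_ne hi.1 a)

theorem sat_exists_set {i j : ℕ} (hj : (1, j) ∉ φ.vars) :
    S.Sat (.ex 1 j (.all 0 i (.iff (.mem 0 i j) φ))) e ↔
      ∃ b, ∀ x, S.mem 0 x b ↔ S.Sat φ (e.assign 0 i x) := by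
  simp [Valuation.assign_comm e one_ne_zero, sat_assign_of_notMem_vars hj]

theorem sat_exists_rel {i j k : ℕ} (hij : i ≠ j) (hk : (3, k) ∉ φ.vars) :
    S.Sat (.ex 3 k (.all 0 i (.all 0 j (.iff (.rel k i j) φ)))) e ↔
      ∃ b, ∀ x y, S.Rel b x y ↔ S.Sat φ ((e.assign 0 i x).assign 0 j y) := by
  simp [Valuation.assign_comm _ three_ne_zero, sat_assign_of_notMem_vars hk, hij]

end LevelStructure

/-! ### Relations coded in the standard universe -/

instance Level.instInhabited : ∀ n, Inhabited (Level n)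
  | 0 => ⟨(0 : ℕ)⟩
  | n + 1 => ⟨(∅ : Set (Level n))⟩

instance Level.instLinearOrder : LinearOrder (Level 0) := inferInstanceAs (LinearOrder ℕ)

instance Level.instWellFoundedLT : WellFoundedLT (Level 0) := inferInstanceAs (WellFoundedLT ℕ)

/-- The Kuratowski pair of two natural numbers, as an object of the standard universe. -/
def kuratowskiPair (x y : Level 0) : Level 2 := ({{x}, {x, y}} : Set (Set (Level 0)))

theorem kuratowskiPair_inj {x y x' y' : Level 0} :
    kuratowskiPair x y = kuratowskiPair x' y' ↔ x = x' ∧ y = y' := by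
  have singleton_eq_pair (a b c : Level 0) : ({a} : Set (Level 0)) = {b, c} ↔ a = b ∧ a = c := by
    rw [← Set.pair_eq_singleton a, Set.pair_eq_pair_iff]; tauto
  have pair_eq_singleton (a b c : Level 0) : ({b, c} : Set (Level 0)) = {a} ↔ a = b ∧ a = c :=
    eq_comm.trans (singleton_eq_pair a b c)
  change ({{x}, {x, y}} : Set (Set (Level 0))) = {{x'}, {x', y'}} ↔ _
  simp only [Set.pair_eq_pair_iff, singleton_eq_pair, pair_eq_singleton,
    Set.singleton_eq_singleton_iff]
  grind

theorem eq_kuratowskiPair_iff {p : Level 2} {x y : Level 0} :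
    p = kuratowskiPair x y ↔ ∀ c : Level 1, standard.mem 1 c p ↔
      (∀ z : Level 0, standard.mem 0 z c ↔ z = x) ∨
        (∀ z : Level 0, standard.mem 0 z c ↔ z = x ∨ z = y) := by
  refine Set.ext_iff.trans (forall_congr' fun c => iff_congr Iff.rfl ?_)
  exact or_congr Set.ext_iff Set.ext_iff

/-- The object of the standard universe which codes a binary relation on `ℕ`. -/
def relCode (R : Level 0 → Level 0 → Prop) : Level 3 :=
  ({p | ∃ x y, R x y ∧ p = kuratowskiPair x y} : Set (Level 2))

theorem standard_rel_relCode (R : Level 0 → Level 0 → Prop) (x y : Level 0) :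
    standard.Rel (relCode R) x y ↔ R x y := by
  constructor
  · rintro ⟨p, hp, x', y', hR, rfl⟩
    obtain ⟨rfl, rfl⟩ := kuratowskiPair_inj.1 (eq_kuratowskiPair_iff.2 hp)
    exact hR
  · exact fun h => ⟨kuratowskiPair x y, eq_kuratowskiPair_iff.1 rfl, x, y, h, rfl⟩

theorem exists_kernel_of_wellFounded {α : Type*} {r : α → α → Prop} (hr : WellFounded r) :
    ∃ A : Set α, ∀ x, x ∈ A ↔ ∀ y, r y x → y ∉ A :=
  ⟨{x | hr.fix (fun x A => ∀ y (h : r y x), ¬ A y h) x}, fun x => by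
    rw [Set.mem_ofPred_eq, hr.fix_eq]; rfl⟩

namespace NonstandardUniverse

variable {U : NonstandardUniverse.{u}} {P Q : Set (U.HyperNat × U.HyperNat)} {A : Set U.HyperNat}

/-! ### Transfer and internal definition -/

instance (n : ℕ) : Inhabited (U.Obj n) := ⟨U.star n default⟩

/-- Transfer for open formulas: the variables in `C` denote standard objects, all others are
universally quantified. -/
theorem sat_of_forall_standard {φ : Formula} (C : Set (ℕ × ℕ)) (d : standard.Valuation)
    (h : ∀ e : standard.Valuation, (∀ n i, (n, i) ∈ C → e n i = d n i) → standard.Sat φ e)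
    {e : U.Valuation} (he : ∀ n i, (n, i) ∈ C → e n i = U.star n (d n i)) : U.Sat φ e := by
  classical
  let l := (φ.vars.filter (· ∉ C)).toList
  have h_closure : standard.Sat (φ.allList l) d :=
    LevelStructure.sat_allList.2 fun e' he' => h e' fun n i hi => he' n i (by simp [l, hi])
  have h_mixed := LevelStructure.sat_allList.1 ((U.transfer _ d).1 h_closure)
    (fun n i => if (n, i) ∈ l then e n i else U.star n (d n i)) fun n i hi => if_neg hi
  refine (LevelStructure.sat_congr fun n i hi => ?_).1 h_mixed
  by_cases hC : (n, i) ∈ C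
  · simp [l, hC, he n i hC]
  · simp [l, hC, hi]

theorem sat_of_standard_valid {φ : Formula} (h : ∀ e : standard.Valuation, standard.Sat φ e)
    (e : U.Valuation) : U.Sat φ e :=
  sat_of_forall_standard ∅ default (fun e _ => h e) fun _ _ h => h.elim

theorem isInternal_setOf_sat (φ : Formula) (i : ℕ) (e : U.Valuation) :
    U.IsInternal {x | U.Sat φ (e.assign 0 i x)} := by
  obtain ⟨j, hj⟩ := φ.exists_notMem_vars 1
  obtain ⟨b, hb⟩ := (LevelStructure.sat_exists_set hj).1 <| sat_of_standard_valid
    (fun d => (LevelStructure.sat_exists_set hj).2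
      ⟨({x | standard.Sat φ (d.assign 0 i x)} : Set (Level 0)), fun _ => Iff.rfl⟩) e
  exact ⟨b, Set.ext fun x => (hb x).symm⟩

theorem isInternalRel_setOf_sat (φ : Formula) {i j : ℕ} (hij : i ≠ j) (e : U.Valuation) :
    U.IsInternalRel {q | U.Sat φ ((e.assign 0 i q.1).assign 0 j q.2)} := by
  obtain ⟨k, hk⟩ := φ.exists_notMem_vars 3
  obtain ⟨b, hb⟩ := (LevelStructure.sat_exists_rel hij hk).1 <| sat_of_standard_valid
    (fun d => (LevelStructure.sat_exists_rel hij hk).2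
      ⟨_, standard_rel_relCode fun x y => standard.Sat φ ((d.assign 0 i x).assign 0 j y)⟩) e
  exact ⟨b, Set.ext fun q => (hb q.1 q.2).symm⟩

/-! ### Internal sets and relations -/

theorem IsInternal.exists_mem_iff (hA : U.IsInternal A) : ∃ b, ∀ x, U.mem 0 x b ↔ x ∈ A :=
  hA.imp fun _ hb _ => (Set.ext_iff.1 hb _).symm

theorem IsInternalRel.exists_rel_iff (hP : U.IsInternalRel P) :
    ∃ b, ∀ x y, U.Rel b x y ↔ (x, y) ∈ P :=
  hP.imp fun _ hb x y => (Set.ext_iff.1 hb (x, y)).symm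

theorem isInternal_univ : U.IsInternal Set.univ := by
  simpa using isInternal_setOf_sat (U := U) (.eq 0 0 0) 0 default

theorem isInternalRel_univ : U.IsInternalRel Set.univ := by
  simpa using isInternalRel_setOf_sat (U := U) (.eq 0 0 0) zero_ne_one default

theorem IsInternal.diff_singleton (hA : U.IsInternal A) (x : U.HyperNat) :
    U.IsInternal (A \ {x}) := by
  obtain ⟨a, ha⟩ := hA.exists_mem_iff
  simpa [ha, Set.sdiff_eq, Set.inter_def] using
    isInternal_setOf_sat (.and (.mem 0 0 0) (.neg (.eq 0 0 1))) 0
    (((default : U.Valuation).assign 1 0 a).assign 0 1 x)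

theorem IsInternal.diff_finite (hA : U.IsInternal A) {F : Set U.HyperNat} (hF : F.Finite) :
    U.IsInternal (A \ F) := by
  induction F, hF using Set.Finite.induction_on with
  | empty => rwa [Set.sdiff_empty]
  | @insert a s _ _ ih =>
    rw [← Set.union_singleton, ← Set.sdiff_sdiff]
    exact ih.diff_singleton a

theorem IsInternal.preimage_fst (hA : U.IsInternal A) : U.IsInternalRel (Prod.fst ⁻¹' A) := by
  obtain ⟨a, ha⟩ := hA.exists_mem_iff
  simpa [ha, Set.preimage] using
    isInternalRel_setOf_sat (.mem 0 0 0) zero_ne_one ((default : U.Valuation).assign 1 0 a)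

theorem IsInternal.preimage_snd (hA : U.IsInternal A) : U.IsInternalRel (Prod.snd ⁻¹' A) := by
  obtain ⟨a, ha⟩ := hA.exists_mem_iff
  simpa [ha, Set.preimage] using
    isInternalRel_setOf_sat (.mem 0 1 0) zero_ne_one ((default : U.Valuation).assign 1 0 a)

theorem IsInternalRel.compl (hP : U.IsInternalRel P) : U.IsInternalRel Pᶜ := by
  obtain ⟨a, ha⟩ := hP.exists_rel_iff
  simpa [ha, Set.compl_def] using
    isInternalRel_setOf_sat (.neg (.rel 0 0 1)) zero_ne_one ((default : U.Valuation).assign 3 0 a)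

theorem IsInternalRel.inter (hP : U.IsInternalRel P) (hQ : U.IsInternalRel Q) :
    U.IsInternalRel (P ∩ Q) := by
  obtain ⟨a, ha⟩ := hP.exists_rel_iff
  obtain ⟨b, hb⟩ := hQ.exists_rel_iff
  simpa [ha, hb] using isInternalRel_setOf_sat (.and (.rel 0 0 1) (.rel 1 0 1)) zero_ne_one
    (((default : U.Valuation).assign 3 0 a).assign 3 1 b)

theorem IsInternalRel.sdiff (hP : U.IsInternalRel P) (hQ : U.IsInternalRel Q) :
    U.IsInternalRel (P \ Q) :=
  hP.inter hQ.compl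

theorem IsInternalRel.slice (hP : U.IsInternalRel P) (x : U.HyperNat) :
    U.IsInternal {y | (x, y) ∈ P} := by
  obtain ⟨a, ha⟩ := hP.exists_rel_iff
  simpa [ha] using isInternal_setOf_sat (.rel 0 0 1) 1
    (((default : U.Valuation).assign 3 0 a).assign 0 0 x)

theorem IsInternalRel.dom (hP : U.IsInternalRel P) : U.IsInternal {x | ∃ y, (x, y) ∈ P} := by
  obtain ⟨a, ha⟩ := hP.exists_rel_iff
  simpa [ha] using
    isInternal_setOf_sat (.ex 0 1 (.rel 0 0 1)) 0 ((default : U.Valuation).assign 3 0 a)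

/-! ### The order of the hyperintegers -/

/-- The extension to `*ℕ` of the order of `ℕ`. -/
def Lt (U : NonstandardUniverse.{u}) (x y : U.HyperNat) : Prop :=
  U.Rel (U.star 3 (relCode (· < ·))) x y

/-- The valuation which assigns to `v 3 0` the order of `*ℕ`. -/
def ltValuation (U : NonstandardUniverse.{u}) : U.Valuation :=
  (default : U.Valuation).assign 3 0 (U.star 3 (relCode (· < ·)))

@[simp] theorem rel_ltValuation (x y : U.HyperNat) : U.Rel (U.ltValuation 3 0) x y ↔ U.Lt x y := by
  simp [ltValuation, Lt]

theorem sat_ltValuation {φ : Formula}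
    (h : ∀ d : standard.Valuation, d 3 0 = relCode (· < ·) → standard.Sat φ d) :
    U.Sat φ U.ltValuation :=
  sat_of_forall_standard {(3, 0)}
    (LevelStructure.Valuation.assign default 3 0 (relCode (· < ·)))
    (fun d hd => h d (by simpa using hd)) (by simp [ltValuation])

theorem lt_trichotomy (x y : U.HyperNat) : U.Lt x y ∨ x = y ∨ U.Lt y x := by
  have h : U.Sat (.all 0 0 (.all 0 1 (.or (.rel 0 0 1) (.or (.eq 0 0 1) (.rel 0 1 0)))))
      U.ltValuation := sat_ltValuation fun d hd => by
    simpa [hd, standard_rel_relCode] using _root_.lt_trichotomy (α := Level 0)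
  simp only [LevelStructure.sat_all] at h
  simpa using h x y

theorem IsInternal.exists_least (hA : U.IsInternal A) {x : U.HyperNat} (hx : x ∈ A) :
    ∃ y ∈ A, ∀ z, U.Lt z y → z ∉ A := by
  obtain ⟨a, ha⟩ := hA.exists_mem_iff
  have h : U.Sat (.all 1 0 (.all 0 0 (.imp (.mem 0 0 0)
      (.ex 0 1 (.and (.mem 0 1 0) (.all 0 2 (.imp (.rel 0 2 1) (.neg (.mem 0 2 0)))))))))
      U.ltValuation := sat_ltValuation fun d hd => by
    have standard_exists_least (A : Level 1) (x : Level 0)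
        (hx : standard.mem 0 x A) : ∃ y : Level 0, standard.mem 0 y A ∧
          ∀ z < y, ¬ standard.mem 0 z A := by
      obtain ⟨y, hy, hmin⟩ := wellFounded_lt.has_min (α := Level 0) A ⟨x, hx⟩
      exact ⟨y, hy, fun z hzy hz => hmin z hz hzy⟩
    simpa [hd, standard_rel_relCode] using standard_exists_least
  simp only [LevelStructure.sat_all, LevelStructure.sat_imp] at h
  simpa [ha] using h a x (by simpa [ha] using hx)

theorem IsInternalRel.exists_kernel (hP : U.IsInternalRel P) :
    ∃ A, U.IsInternal A ∧ ∀ x, x ∈ A ↔ ∀ y, U.Lt y x → (x, y) ∈ P → y ∉ A := by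
  obtain ⟨a, ha⟩ := hP.exists_rel_iff
  have h : U.Sat (.all 3 1 (.ex 1 0 (.all 0 0 (.iff (.mem 0 0 0)
      (.all 0 1 (.imp (.rel 0 1 0) (.imp (.rel 1 0 1) (.neg (.mem 0 1 0)))))))))
      U.ltValuation := sat_ltValuation fun d hd => by
    have standard_exists_kernel (R : Level 3) : ∃ A : Level 1, ∀ x : Level 0,
        standard.mem 0 x A ↔ ∀ y < x, standard.Rel R x y → ¬ standard.mem 0 y A := by
      obtain ⟨A, hA⟩ := exists_kernel_of_wellFounded (r := fun y x => y < x ∧ standard.Rel R x y)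
        (Subrelation.wf And.left wellFounded_lt)
      exact ⟨A, fun x => (hA x).trans (forall_congr' fun y => and_imp)⟩
    simpa [hd, standard_rel_relCode] using standard_exists_kernel
  simp only [LevelStructure.sat_all] at h
  obtain ⟨b, hb⟩ : ∃ b, ∀ x, U.mem 0 x b ↔ ∀ y, U.Lt y x → (x, y) ∈ P → ¬ U.mem 0 y b := by
    simpa [ha] using h a
  exact ⟨_, ⟨b, rfl⟩, hb⟩

theorem IsInternalRel.exists_separating (hP : U.IsInternalRel P)
    (huniq : Relator.RightUnique fun x y => (x, y) ∈ P) :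
    ∃ A, U.IsInternal A ∧ ∀ x y, (x, y) ∈ P → U.Lt y x → ¬ (x ∈ A ↔ y ∈ A) := by
  obtain ⟨A, hA, hkernel⟩ := hP.exists_kernel
  refine ⟨A, hA, fun x y hxy hlt hiff => ?_⟩
  have hx : x ∈ A ↔ y ∉ A := (hkernel x).trans
    ⟨fun h => h y hlt hxy, fun hy z _ hxz => huniq hxy hxz ▸ hy⟩
  exact iff_not_self (hiff.symm.trans hx)

/-- The graph of the partial function which maps `x` to the least point of the section of `P`
at `x`. -/
def leastGraph (P : Set (U.HyperNat × U.HyperNat)) : Set (U.HyperNat × U.HyperNat) :=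
  {q | q ∈ P ∧ ∀ z, U.Lt z q.2 → (q.1, z) ∉ P}

/-- The relation `P` without the least point of each section. Iterating it exhausts the finite
sections of an internal relation. -/
def removeLeast (P : Set (U.HyperNat × U.HyperNat)) : Set (U.HyperNat × U.HyperNat) :=
  P \ leastGraph P

theorem IsInternalRel.leastGraph (hP : U.IsInternalRel P) : U.IsInternalRel (leastGraph P) := by
  obtain ⟨a, ha⟩ := hP.exists_rel_iff
  simpa [ha, NonstandardUniverse.leastGraph] using isInternalRel_setOf_sat
    (.and (.rel 1 0 1) (.all 0 2 (.imp (.rel 0 2 1) (.neg (.rel 1 0 2))))) zero_ne_one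
    (U.ltValuation.assign 3 1 a)

theorem IsInternalRel.iterate_removeLeast (hP : U.IsInternalRel P) (i : ℕ) :
    U.IsInternalRel (removeLeast^[i] P) := by
  induction i generalizing P with
  | zero => exact hP
  | succ _ ih => exact ih (hP.sdiff hP.leastGraph)

theorem rightUnique_leastGraph : Relator.RightUnique fun x y => (x, y) ∈ leastGraph P := by
  intro x y z hy hz
  rcases lt_trichotomy y z with hlt | heq | hlt
  · exact (hz.2 y hlt hy.1).elim
  · exact heq
  · exact (hy.2 z hlt hz.1).elim

theorem IsInternalRel.exists_mem_leastGraph (hP : U.IsInternalRel P) {x y : U.HyperNat}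
    (hxy : (x, y) ∈ P) : ∃ z, (x, z) ∈ NonstandardUniverse.leastGraph P :=
  (hP.slice x).exists_least hxy

theorem IsInternalRel.exists_mem_leastGraph_iterate (hP : U.IsInternalRel P) {x y : U.HyperNat}
    (hfin : {z | (x, z) ∈ P}.Finite) (hxy : (x, y) ∈ P) :
    ∃ i, (x, y) ∈ NonstandardUniverse.leastGraph (removeLeast^[i] P) := by
  induction hn : {z | (x, z) ∈ P}.ncard using Nat.strong_induction_on generalizing P with
  | _ n ih =>
    by_cases hy : (x, y) ∈ NonstandardUniverse.leastGraph P
    · exact ⟨0, hy⟩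
    · obtain ⟨z, hz⟩ := hP.exists_mem_leastGraph hxy
      have hssub : {w | (x, w) ∈ removeLeast P} ⊂ {w | (x, w) ∈ P} :=
        ⟨fun w hw => hw.1, fun hsub => (hsub hz.1).2 hz⟩
      obtain ⟨i, hi⟩ := ih _ (hn ▸ Set.ncard_lt_ncard hssub hfin) (hP.iterate_removeLeast 1)
        (hfin.subset hssub.subset) ⟨hxy, hy⟩ rfl
      exact ⟨i + 1, hi⟩

/-! ### Saturation -/

theorem CountablySaturated.nonempty_iInter (hU : U.CountablySaturated) {X : ℕ → Set U.HyperNat}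
    (hX : ∀ k, U.IsInternal (X k)) (hanti : Antitone X) (hne : ∀ k, (X k).Nonempty) :
    (⋂ k, X k).Nonempty := by
  choose b hb using fun k => (hX k).exists_mem_iff
  obtain ⟨x, hx⟩ := hU 0 b fun k =>
    (hne k).imp fun x hx i hi => (hb i x).2 (hanti hi hx)
  exact ⟨x, Set.mem_iInter.2 fun k => (hb k x).1 (hx k)⟩

theorem CountablySaturated.exists_finite_of_countable_iInter (hU : U.CountablySaturated)
    {X : ℕ → Set U.HyperNat} (hX : ∀ k, U.IsInternal (X k)) (hanti : Antitone X)
    (hcount : (⋂ k, X k).Countable) : ∃ k, (X k).Finite := by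
  by_contra! hinf
  obtain ⟨a, ha⟩ := hcount.exists_eq_range
    (hU.nonempty_iInter hX hanti fun k => (hinf k).nonempty)
  have hfin (k : ℕ) : (a '' Set.Iic k).Finite := (Set.finite_Iic k).image a
  obtain ⟨x, hx⟩ := hU.nonempty_iInter (X := fun k => X k \ a '' Set.Iic k)
    (fun k => (hX k).diff_finite (hfin k))
    (fun i j hij => Set.sdiff_subset_sdiff (hanti hij) (Set.image_mono (Set.Iic_subset_Iic.2 hij)))
    (fun k => ((hinf k).sdiff (hfin k)).nonempty)
  rw [Set.mem_iInter] at hx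
  obtain ⟨j, rfl⟩ : x ∈ Set.range a := ha ▸ Set.mem_iInter.2 fun k => (hx k).1
  exact (hx j).2 ⟨j, Set.mem_Iic.2 le_rfl, rfl⟩

end NonstandardUniverse

/-! ### Countably determined sets -/

section CountablyDetermined

variable {α β : Type u} {𝓘 : Set α → Prop} {𝓙 : Set β → Prop} {ι κ : Type*} {X X' : Set α}
  {Y : ι → Set α}

/-- The sets `Y i` determine `X`: whether a point lies in `X` depends only on which of the sets
`Y i` contain it. Countable determination amounts to this for a countable family. -/
def Determines (Y : ι → Set α) (X : Set α) : Prop :=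
  ∀ x x', (∀ i, x ∈ Y i ↔ x' ∈ Y i) → x ∈ X → x' ∈ X

theorem Determines.compl (h : Determines Y X) : Determines Y Xᶜ :=
  fun x x' hxx' hx hx' => hx (h x' x (fun i => (hxx' i).symm) hx')

theorem Determines.inter_elim {Z : κ → Set α} (hX : Determines Y X) (hX' : Determines Z X') :
    Determines (Sum.elim Y Z) (X ∩ X') :=
  fun x x' hxx' hx =>
    ⟨hX x x' (fun i => hxx' (.inl i)) hx.1, hX' x x' (fun k => hxx' (.inr k)) hx.2⟩

theorem CountablyDetermined.exists_determines (hX : CountablyDetermined 𝓘 X) :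
    ∃ Y : ℕ → Set α, (∀ m, 𝓘 (Y m)) ∧ Determines Y X := by
  obtain ⟨Y, B, hY, rfl⟩ := hX
  refine ⟨Y, hY, fun x x' hxx' hx => ?_⟩
  simpa only [Set.mem_iUnion, Set.mem_inter_iff, Set.mem_iInter, Set.mem_sdiff, hxx'] using hx

theorem Determines.countablyDetermined_of_cover {Y : ℕ → Set α} (hX : Determines Y X)
    (hY : ∀ m, 𝓘 (Y m)) (hcover : ⋃ m, Y m = Set.univ) : CountablyDetermined 𝓘 X := by
  refine ⟨Y, {b | ∃ x ∈ X, b = {m | x ∈ Y m}}, hY, ?_⟩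
  ext x'
  simp only [hcover, Set.mem_iUnion, Set.mem_inter_iff, Set.mem_iInter, Set.mem_sdiff,
    Set.mem_univ, true_and]
  constructor
  · exact fun hx' => ⟨_, ⟨x', hx', rfl⟩, fun _ hm => hm, fun _ hm => hm⟩
  · rintro ⟨_, ⟨x, hx, rfl⟩, hmem, hnotMem⟩
    exact hX x x' (fun m => ⟨hmem m, not_imp_not.1 (hnotMem m)⟩) hx

theorem Determines.countablyDetermined [Countable ι] (hX : Determines Y X)
    (huniv : 𝓘 Set.univ) (hY : ∀ i, 𝓘 (Y i)) : CountablyDetermined 𝓘 X := by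
  obtain ⟨f, hf⟩ := exists_surjective_nat (Option ι)
  let Z : Option ι → Set α := fun o => o.elim Set.univ Y
  have hZ : ∀ o, 𝓘 (Z o) := Option.forall.2 ⟨huniv, hY⟩
  refine Determines.countablyDetermined_of_cover (Y := Z ∘ f) (fun x x' hxx' => ?_)
    (fun m => hZ (f m)) ?_
  · exact hX x x' fun i => (hf.forall (p := fun o => x ∈ Z o ↔ x' ∈ Z o)).2 hxx' (some i)
  · exact hf.iUnion_comp Z ▸ Set.eq_univ_of_forall fun x => Set.mem_iUnion.2 ⟨none, trivial⟩

theorem CountablyDetermined.compl (hX : CountablyDetermined 𝓘 X) (huniv : 𝓘 Set.univ) :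
    CountablyDetermined 𝓘 Xᶜ := by
  obtain ⟨Y, hY, hYX⟩ := hX.exists_determines
  exact hYX.compl.countablyDetermined huniv hY

theorem CountablyDetermined.inter (hX : CountablyDetermined 𝓘 X)
    (hX' : CountablyDetermined 𝓘 X') (huniv : 𝓘 Set.univ) :
    CountablyDetermined 𝓘 (X ∩ X') := by
  obtain ⟨Y, hY, hYX⟩ := hX.exists_determines
  obtain ⟨Z, hZ, hZX⟩ := hX'.exists_determines
  exact (hYX.inter_elim hZX).countablyDetermined huniv (Sum.forall.2 ⟨hY, hZ⟩)

theorem CountablyDetermined.preimage {f : β → α} (hX : CountablyDetermined 𝓘 X)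
    (hf : ∀ A, 𝓘 A → 𝓙 (f ⁻¹' A)) : CountablyDetermined 𝓙 (f ⁻¹' X) := by
  obtain ⟨Y, B, hY, rfl⟩ := hX
  exact ⟨fun m => f ⁻¹' Y m, B, fun m => hf _ (hY m), by ext; simp⟩

/-- The set of the points which lie in exactly those of the first `k` sets `Y m` for which
`m ∈ s`. These finite-stage approximations are internal if the `Y m` are. -/
def cylinder (Y : ℕ → Set α) (k : ℕ) (s : Set ℕ) : Set α :=
  {x | ∀ m < k, x ∈ Y m ↔ m ∈ s}

variable {Y : ℕ → Set α}

theorem antitone_cylinder (s : Set ℕ) : Antitone fun k => cylinder Y k s :=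
  fun _ _ hkl _ hx m hm => hx m (hm.trans_le hkl)

theorem mem_cylinder_self (k : ℕ) (x : α) : x ∈ cylinder Y k {m | x ∈ Y m} :=
  fun _ _ => Iff.rfl

theorem exists_finset_cylinder_eq (k : ℕ) (s : Set ℕ) :
    ∃ t : Finset ℕ, cylinder Y k t = cylinder Y k s := by
  classical
  exact ⟨{m ∈ Finset.range k | m ∈ s}, Set.ext fun x => forall₂_congr fun m hm => by simp [hm]⟩

theorem Determines.mem_of_forall_mem_cylinder (hX : Determines Y X) {x x' : α} (hx : x ∈ X)
    (hx' : ∀ k, x' ∈ cylinder Y k {m | x ∈ Y m}) : x' ∈ X :=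
  hX x x' (fun m => (hx' (m + 1) m m.lt_succ_self).symm) hx

theorem cylinder_succ (k : ℕ) (s : Set ℕ) :
    cylinder Y (k + 1) s = cylinder Y k s ∩ {x | x ∈ Y k ↔ k ∈ s} := by
  simp only [cylinder, Nat.forall_lt_succ_right, Set.ofPred_and]

end CountablyDetermined

namespace NonstandardUniverse

variable {U : NonstandardUniverse.{u}} {P : Set (U.HyperNat × U.HyperNat)}

theorem isInternalRel_cylinder {Y : ℕ → Set (U.HyperNat × U.HyperNat)}
    (hY : ∀ m, U.IsInternalRel (Y m)) (k : ℕ) (s : Set ℕ) : U.IsInternalRel (cylinder Y k s) := by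
  induction k with
  | zero => simpa [cylinder] using isInternalRel_univ (U := U)
  | succ k ih =>
    rw [cylinder_succ]
    by_cases hk : k ∈ s
    · simpa [hk] using ih.inter (hY k)
    · simpa [hk, Set.compl_def] using ih.inter (hY k).compl

theorem IsCDRel.dom (hP : U.IsCDRel P) (hU : U.CountablySaturated) :
    U.IsCD {x | ∃ y, (x, y) ∈ P} := by
  obtain ⟨Y, hY, hYP⟩ := hP.exists_determines
  refine Determines.countablyDetermined (ι := ℕ × Finset ℕ)
    (Y := fun c => {x | ∃ y, (x, y) ∈ cylinder Y c.1 c.2}) ?_ isInternal_univ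
    fun c => (isInternalRel_cylinder hY c.1 c.2).dom
  rintro x x' hxx' ⟨y, hxy⟩
  let b : Set ℕ := {m | (x, y) ∈ Y m}
  have hne (k : ℕ) : {z | (x', z) ∈ cylinder Y k b}.Nonempty := by
    obtain ⟨t, ht⟩ := exists_finset_cylinder_eq (Y := Y) k b
    exact ht ▸ (hxx' (k, t)).1 ⟨y, ht.symm ▸ mem_cylinder_self k (x, y)⟩
  obtain ⟨y', hy'⟩ := hU.nonempty_iInter (fun k => (isInternalRel_cylinder hY k b).slice x')
    (fun _ _ hkl _ hz => antitone_cylinder b hkl hz) hne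
  exact ⟨y', hYP.mem_of_forall_mem_cylinder hxy fun k => Set.mem_iInter.1 hy' k⟩

/-! ### Relations with countable sections -/

theorem IsCDRel.exists_cover (hP : U.IsCDRel P) (hU : U.CountablySaturated)
    (hcount : ∀ x, {y | (x, y) ∈ P}.Countable) :
    ∃ G : ℕ × Finset ℕ × ℕ → Set (U.HyperNat × U.HyperNat), (∀ c, U.IsInternalRel (G c)) ∧
      (∀ c, Relator.RightUnique fun x y => (x, y) ∈ G c) ∧ P ⊆ ⋃ c, G c := by
  obtain ⟨Y, hY, hYP⟩ := hP.exists_determines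
  refine ⟨fun c => leastGraph (removeLeast^[c.2.2] (cylinder Y c.1 c.2.1)),
    fun c => ((isInternalRel_cylinder hY _ _).iterate_removeLeast _).leastGraph,
    fun c => rightUnique_leastGraph, ?_⟩
  rintro ⟨x, y⟩ hxy
  let b : Set ℕ := {m | (x, y) ∈ Y m}
  have hsub : ⋂ k, {z | (x, z) ∈ cylinder Y k b} ⊆ {z | (x, z) ∈ P} :=
    fun z hz => hYP.mem_of_forall_mem_cylinder hxy fun k => Set.mem_iInter.1 hz k
  obtain ⟨k, hfin⟩ := hU.exists_finite_of_countable_iInter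
    (fun k => (isInternalRel_cylinder hY k b).slice x)
    (fun _ _ hkl _ hz => antitone_cylinder b hkl hz) ((hcount x).mono hsub)
  obtain ⟨t, ht⟩ := exists_finset_cylinder_eq (Y := Y) k b
  obtain ⟨i, hi⟩ := (isInternalRel_cylinder hY k b).exists_mem_leastGraph_iterate hfin
    (mem_cylinder_self k (x, y))
  exact Set.mem_iUnion.2 ⟨(k, t, i), ht.symm ▸ hi⟩

theorem IsCDRel.exists_separating (hP : U.IsCDRel P) (hU : U.CountablySaturated)
    (hcount : ∀ x, {y | (x, y) ∈ P}.Countable) :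
    ∃ A : ℕ → Set U.HyperNat, (∀ n, U.IsInternal (A n)) ∧
      ∀ x y, (x, y) ∈ P → U.Lt y x → ∃ n, ¬ (x ∈ A n ↔ y ∈ A n) := by
  obtain ⟨G, hG, huniq, hcover⟩ := hP.exists_cover hU hcount
  choose A hA hsep using fun c => (hG c).exists_separating (huniq c)
  obtain ⟨f, hf⟩ := exists_surjective_nat (ℕ × Finset ℕ × ℕ)
  refine ⟨A ∘ f, fun n => hA (f n), fun x y hxy hlt => ?_⟩
  obtain ⟨c, hc⟩ := Set.mem_iUnion.1 (hcover hxy)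
  obtain ⟨n, rfl⟩ := hf c
  exact ⟨n, hsep (f n) x y hc hlt⟩

theorem exists_isInternal_separating_classes (hU : U.CountablySaturated) {E : Setoid U.HyperNat}
    (hE : U.IsCDRel {q | E q.1 q.2}) (hcount : ∀ x, {y | E x y}.Countable) :
    ∃ A : ℕ → Set U.HyperNat, (∀ n, U.IsInternal (A n)) ∧
      ∀ x y, E x y → (∀ n, x ∈ A n ↔ y ∈ A n) → x = y := by
  obtain ⟨A, hA, hsep⟩ := hE.exists_separating hU hcount
  refine ⟨A, hA, fun x y hxy heq => ?_⟩
  rcases lt_trichotomy x y with hlt | rfl | hlt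
  · obtain ⟨n, hn⟩ := hsep y x (E.symm hxy) hlt
    exact (hn (heq n).symm).elim
  · rfl
  · obtain ⟨n, hn⟩ := hsep x y hxy hlt
    exact (hn (heq n)).elim

end NonstandardUniverse

/-! ### Transversals -/

theorem isTransversal_setOf_minimal {α : Type u} {β : Type*} {E : Setoid α} {τ : α → β}
    (r : β → β → Prop) [IsWellOrder β r] (hτ : ∀ x y, E x y → τ x = τ y → x = y) :
    IsTransversal E {x | ∀ y, E x y → ¬ r (τ y) (τ x)} := by
  intro x
  obtain ⟨_, ⟨y, hxy, rfl⟩, hmin⟩ :=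
    (IsWellFounded.wf (r := r)).has_min (τ '' {y | E x y}) ⟨τ x, x, E.refl x, rfl⟩
  refine ⟨y, ⟨fun z hyz => hmin _ ⟨z, E.trans hxy hyz, rfl⟩, hxy⟩, fun z hz => ?_⟩
  have hzy : E z y := E.trans (E.symm hz.2) hxy
  exact hτ z y hzy (Std.Trichotomous.trichotomous _ _ (hmin _ ⟨z, hz.2, rfl⟩) (hz.1 y hzy))

namespace NonstandardUniverse

variable {U : NonstandardUniverse.{u}} {E : Setoid U.HyperNat}

theorem exists_isCD_isTransversal (hU : U.CountablySaturated) (hE : U.IsCDRel {q | E q.1 q.2})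
    (hcount : ∀ x, {y | E x y}.Countable) : ∃ T, U.IsCD T ∧ IsTransversal E T := by
  obtain ⟨A, hA, hinj⟩ := exists_isInternal_separating_classes hU hE hcount
  let τ : U.HyperNat → Set ℕ := fun x => {n | x ∈ A n}
  let S : Set (U.HyperNat × U.HyperNat) := {q | WellOrderingRel (τ q.2) (τ q.1)}
  refine ⟨_, ?_, isTransversal_setOf_minimal (τ := τ) WellOrderingRel
    fun x y hxy heq => hinj x y hxy (Set.ext_iff.1 heq)⟩
  have hS : U.IsCDRel S := by
    refine Determines.countablyDetermined
      (Y := Sum.elim (fun n => Prod.fst ⁻¹' A n) fun n => Prod.snd ⁻¹' A n) ?_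
      isInternalRel_univ (Sum.forall.2 ⟨fun n => (hA n).preimage_fst, fun n => (hA n).preimage_snd⟩)
    intro q q' hqq' hq
    have hfst : τ q.1 = τ q'.1 := Set.ext fun n => hqq' (.inl n)
    have hsnd : τ q.2 = τ q'.2 := Set.ext fun n => hqq' (.inr n)
    simpa only [S, Set.mem_ofPred_eq, hfst, hsnd] using hq
  have hdom : U.IsCD {x | ∃ y, (x, y) ∈ {q | E q.1 q.2} ∩ S} :=
    IsCDRel.dom (hE.inter hS isInternalRel_univ) hU
  simpa [S, Set.compl_def, IsCD] using hdom.compl isInternal_univ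

theorem cdSmooth_of_isTransversal (hE : U.IsCDRel {q | E q.1 q.2}) {T : Set U.HyperNat}
    (hT : U.IsCD T) (hET : IsTransversal E T) : U.CDSmooth E := by
  choose θ hθ hunique using hET
  have hgraph : {q : U.HyperNat × U.HyperNat | θ q.1 = q.2} =
      {q | E q.1 q.2} ∩ Prod.snd ⁻¹' T := by
    ext ⟨x, y⟩
    constructor
    · rintro (rfl : θ x = y)
      exact (hθ x).symm
    · exact fun h => (hunique x y h.symm).symm
  refine ⟨θ, ?_, fun x y => ⟨fun hxy => ?_, fun heq => ?_⟩⟩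
  · rw [IsCDMap, hgraph]
    exact hE.inter (hT.preimage fun _ hA => hA.preimage_snd) isInternalRel_univ
  · exact hunique y (θ x) ⟨(hθ x).1, E.trans (E.symm hxy) (hθ x).2⟩
  · exact E.trans (hθ x).2 (heq ▸ E.symm (hθ y).2)

end NonstandardUniverse

end NonstandardDST

theorem mainTheorem1 (U : NonstandardDST.NonstandardUniverse.{u}) (hU : U.CountablySaturated)
    (E : Setoid U.HyperNat) (hE : U.IsCDRel {q | E q.1 q.2})
    (hcount : ∀ x : U.HyperNat, {y | E x y}.Countable) :
    (∃ T : Set U.HyperNat, U.IsCD T ∧ NonstandardDST.IsTransversal E T) ∧ U.CDSmooth E := by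
  obtain ⟨T, hT, hET⟩ := NonstandardDST.NonstandardUniverse.exists_isCD_isTransversal hU hE hcount
  exact ⟨⟨T, hT, hET⟩, NonstandardDST.NonstandardUniverse.cdSmooth_of_isTransversal hE hT hET⟩
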